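/- Let $X,Y$ be Banach spaces over $\mathbb K\in\{\mathbb R,\mathbb C\}$, let $1\le p<\infty$ and let $p^*\in(1,\infty]$ be given by $\frac1p+\frac1{p^*}=1$. For a Banach space $Z$ and $1\le r\le\infty$ (with $\frac1r+\frac1{r^*}=1$) consider the following normed spaces of sequences in $Z$: - $\ell_r^w(Z)$: all $(z_j)_j$ with $(f(z_j))_j\in\ell_r$ for every $f\in Z^*$, with $\|(z_j)_j\|_r^w=\sup_{\|f\|\le1}\|(f(z_j))_j\|_r$; - $\ell_p^{mid}(Z)$: all $(z_j)_j$ with $\sum_n\sum_j|f_n(z_j)|^p<\infty$ for every $(f_n)_n\in\ell_p^w(Z^*)$, with $\|(z_j)_j\|_p^{mid}=\sup\{(\sum_n\sum_j|f_n(z_j)|^p)^{1/p}:\|(f_n)_n\|_p^w\le1\}$; - $(\ell_p^{mid})^{dual}(Z)$: all $(z_j)_j$ with $\sum_j|f_j(z_j)|<\infty$ for every $(f_j)_j\in\ell_p^{mid}(Z^*)$, with $\|(z_j)_j\|_{p,mid}^{dual}=\sup\{\sum_j|f_j(z_j)|:\|(f_j)_j\|_p^{mid}\le1\}$; - $\ell_r\langle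 Z\rangle$: all $(z_j)_j$ with $\sum_j|f_j(z_j)|<\infty$ for every $(f_j)_j\in\ell_{r^*}^w(Z^*)$, with $\|(z_j)_j\|_{C,r}=\sup\{\sum_j|f_j(z_j)|:\|(f_j)_j\|_{r^*}^w\le1\}$. For a continuous linear operator $T$ write $\hat T((x_j)_j)=(Tx_j)_j$. For Banach spaces $E,F$ let $W_p^{mid}(E,F)$ be the set of those $T\in\mathcal L(E,F)$ for which $\hat T:\ell_p^w(E)\to\ell_p^{mid}(F)$ is well defined and continuous (the weakly mid $p$-summing operators), with $w_p^{mid}(T)=\sup\{\pi_p(ST): S\in\mathcal L(F,\ell_p),\ \|S\|\le1\}$, where $\pi_p(R)$ is the norm of $\hat R:\ell_p^w(E)\to\ell_p(G)$ for $R\in\mathcal L(E,G)$ (and $\infty$ if this map is not well defined and continuous). Let $(W_p^{mid})^{dual}(X,Y)=\{T\in\mathcal L(X,Y):T^*\in W_p^{mid}(Y^*,X^*)\}$, with $(w_p^{mid})^{dual}(T)=w_p^{mid}(T^*)$. Then for every $T\in\mathcal L(X,Y)$ the map $\hat T:(\ell_p^{mid})^{dual}(X)\to\ell_{p^*}\langle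 Y\rangle$ is well defined and continuous if and only if $T^*\in W_p^{mid}(Y^*,X^*)$, and in that case $w_p^{mid}(T^*)=\|\hat T\|$. Consequently $$(W_p^{mid})^{dual}(X,Y)=\{T\in\mathcal L(X,Y):\ \hat T:(\ell_p^{mid})^{dual}(X)\to\ell_{p^*}\langle Y\rangle\text{ is well defined and continuous}\},$$ and $(w_p^{mid})^{dual}(T)=\|\hat T\|$ for every $T\in(W_p^{mid})^{dual}(X,Y)$. -/

import Mathlib

open scoped ENNReal

noncomputable section

set_option linter.unusedSectionVars false

/-! ### Norms given by suprema over a unit ball -/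

theorem sup_norm_core {𝕜 S B E : Type*} [RCLike 𝕜] [AddCommGroup S] [Module 𝕜 S] [Norm S]
    [NormedAddCommGroup B] [NormedSpace 𝕜 B] [NormedAddCommGroup E] [NormedSpace 𝕜 E]
    (A : B →ₗ[𝕜] S →ₗ[𝕜] E)
    (hn : ∀ x : S, ‖x‖ = ⨆ b : {b : B // ‖b‖ ≤ 1}, ‖A b x‖)
    (hb : ∀ x : S, ∃ C : ℝ, ∀ b : B, ‖A b x‖ ≤ C * ‖b‖)
    (hs : ∀ x : S, (∀ b : B, A b x = 0) → x = 0) :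
    NormedSpace.Core 𝕜 S ∧ ∀ (b : B) (x : S), ‖A b x‖ ≤ ‖b‖ * ‖x‖ := by
  have : Nonempty ({b : B // ‖b‖ ≤ 1}) := ⟨⟨0, by simp⟩⟩
  have bdd : ∀ x : S, BddAbove (Set.range fun b : {b : B // ‖b‖ ≤ 1} => ‖A b x‖) := by
    intro x
    obtain ⟨C, hC⟩ := hb x
    refine ⟨|C|, ?_⟩
    rintro _ ⟨b, rfl⟩
    have h1 : ‖(b : B)‖ ≤ 1 := b.2
    calc ‖A b x‖ ≤ C * ‖(b : B)‖ := hC b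
      _ ≤ |C| * ‖(b : B)‖ := by gcongr; exact le_abs_self C
      _ ≤ |C| * 1 := by gcongr
      _ = |C| := mul_one _
  have hle : ∀ (b : B) (x : S), ‖b‖ ≤ 1 → ‖A b x‖ ≤ ‖x‖ := by
    intro b x h
    rw [hn]
    exact le_ciSup (bdd x) ⟨b, h⟩
  have hle2 : ∀ (b : B) (x : S), ‖A b x‖ ≤ ‖b‖ * ‖x‖ := by
    intro b x
    rcases eq_or_ne b 0 with rfl | h0
    · simp
    have hb0 : 0 < ‖b‖ := norm_pos_iff.2 h0
    have h1 := hle (((‖b‖⁻¹ : ℝ) : 𝕜) • b) x (by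
      rw [norm_smul, RCLike.norm_ofReal, abs_of_pos (inv_pos.2 hb0), inv_mul_cancel₀ hb0.ne'])
    rw [map_smul, LinearMap.smul_apply, norm_smul, RCLike.norm_ofReal,
      abs_of_pos (inv_pos.2 hb0), inv_mul_le_iff₀ hb0] at h1
    exact h1
  refine ⟨{ norm_nonneg := ?_, norm_smul := ?_, norm_triangle := ?_, norm_eq_zero_iff := ?_ },
    hle2⟩
  · intro x
    rw [hn]
    exact Real.iSup_nonneg fun _ => norm_nonneg _
  · intro c x
    rw [hn, hn, Real.mul_iSup_of_nonneg (norm_nonneg c)]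
    simp [norm_smul]
  · intro x y
    rw [hn (x + y)]
    refine ciSup_le fun b => ?_
    have h1 : ‖(b : B)‖ ≤ 1 := b.2
    rw [map_add]
    exact (norm_add_le _ _).trans (add_le_add (hle b x h1) (hle b y h1))
  · intro x
    constructor
    · intro h
      refine hs x fun b => ?_
      have := hle2 b x
      rw [h, mul_zero] at this
      exact norm_le_zero_iff.1 this
    · rintro rfl
      rw [hn]
      simp

theorem lp_apply_le {ι 𝕜 : Type*} [RCLike 𝕜] {r : ℝ≥0∞} [Fact (1 ≤ r)]
    (f : lp (fun _ : ι => 𝕜) r) (i : ι) : ‖f i‖ ≤ ‖f‖ :=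
  lp.norm_apply_le_norm (zero_lt_one.trans_le Fact.out).ne' f i

theorem lp_bound {ι 𝕜 B : Type*} [RCLike 𝕜] {r : ℝ≥0∞} [Fact (1 ≤ r)]
    [NormedAddCommGroup B] [NormedSpace 𝕜 B] [CompleteSpace B]
    (L : B →ₗ[𝕜] lp (fun _ : ι => 𝕜) r) (h : ∀ i, Continuous fun b => L b i) :
    ∃ C : ℝ, ∀ b : B, ‖L b‖ ≤ C * ‖b‖ := by
  have hc : Continuous L := by
    refine L.continuous_of_seq_closed_graph fun u x y hu hy => ?_
    ext i
    have h1 : Filter.Tendsto (fun n => L (u n) i) Filter.atTop (nhds (L x i)) :=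
      ((h i).tendsto x).comp hu
    have h2 : Filter.Tendsto (fun n => L (u n) i) Filter.atTop (nhds (y i)) := by
      rw [tendsto_iff_norm_sub_tendsto_zero] at hy ⊢
      refine squeeze_zero (fun _ => norm_nonneg _) (fun n => ?_) hy
      exact lp_apply_le (L (u n) - y) i
    exact tendsto_nhds_unique h2 h1
  exact ⟨‖(⟨L, hc⟩ : B →L[𝕜] _)‖, fun b => (⟨L, hc⟩ : B →L[𝕜] _).le_opNorm b⟩

theorem sup_complete {ι 𝕜 S B : Type*} [RCLike 𝕜] {r : ℝ≥0∞} [Fact (1 ≤ r)]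
    [NormedAddCommGroup S] [NormedSpace 𝕜 S] [NormedAddCommGroup B] [NormedSpace 𝕜 B]
    (A : B →ₗ[𝕜] S →ₗ[𝕜] lp (fun _ : ι => 𝕜) r)
    (hn : ∀ x : S, ‖x‖ = ⨆ b : {b : B // ‖b‖ ≤ 1}, ‖A b x‖)
    (hA : ∀ (b : B) (x : S), ‖A b x‖ ≤ ‖b‖ * ‖x‖)
    (hl : ∀ u : ℕ → S, CauchySeq u →
      (∀ b : B, Bornology.IsBounded (Set.range fun n => A b (u n))) →
      ∃ x : S, ∀ b i, Filter.Tendsto (fun n => A b (u n) i) Filter.atTop (nhds (A b x i))) :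
    CompleteSpace S := by
  have : Nonempty ({b : B // ‖b‖ ≤ 1}) := ⟨⟨0, by simp⟩⟩
  refine Metric.complete_of_cauchySeq_tendsto fun u hu => ?_
  obtain ⟨x, hx⟩ := hl u hu (fun b => by
    exact ((uniformContinuous_addMonoidHom_of_continuous
      (AddMonoidHomClass.continuous_of_bound (A b) ‖b‖ (hA b))).comp_cauchySeq hu).isBounded_range)
  refine ⟨x, ?_⟩
  rw [Metric.tendsto_atTop]
  intro ε hε
  obtain ⟨N, hN⟩ := Metric.cauchySeq_iff.1 hu (ε / 2) (half_pos hε)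
  refine ⟨N, fun n hnN => ?_⟩
  refine lt_of_le_of_lt ?_ (half_lt_self hε)
  rw [dist_eq_norm, hn]
  refine ciSup_le fun b => ?_
  have h1 : ‖(b : B)‖ ≤ 1 := b.2
  refine lp.norm_le_of_tendsto (l := Filter.atTop) (F := fun m => A b (u n - u m)) ?_ ?_
  · filter_upwards [Filter.eventually_ge_atTop N] with m hm
    have h2 := hN n hnN m hm
    rw [dist_eq_norm] at h2
    calc ‖A b (u n - u m)‖ ≤ ‖(b : B)‖ * ‖u n - u m‖ := hA _ _
      _ ≤ 1 * (ε / 2) := by gcongr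
      _ = ε / 2 := one_mul _
  · rw [tendsto_pi_nhds]
    intro i
    simp only [map_sub, lp.coeFn_sub, Pi.sub_apply]
    exact tendsto_const_nhds.sub (hx b i)

variable (𝕜 : Type*) [RCLike 𝕜] (p : ℝ≥0∞) (X : Type*) [NormedAddCommGroup X] [NormedSpace 𝕜 X]

/-! ### Weakly `p`-summable sequences -/

/-- `ℓ_p^w(X)`, for `1 ≤ p ≤ ∞`: the sequences `(x_j)` in `X` with `(f(x_j))_j ∈ ℓ_p` for every
`f ∈ X*`. -/
def WeakSeq : Submodule 𝕜 (PreLp fun _ : ℕ => X) where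
  carrier := {x | ∀ f : StrongDual 𝕜 X, Memℓp (fun j => f (x j)) p}
  zero_mem' f := by simpa using! (zero_memℓp : Memℓp (0 : ℕ → 𝕜) p)
  add_mem' {x y} hx hy f := by
    simpa using! (hx f).add (hy f)
  smul_mem' c x hx f := by
    convert (hx f).const_smul c using 2 with j
    exact map_smul f c (x j)

variable {𝕜 p X}

instance : CoeFun (WeakSeq 𝕜 p X) fun _ => ℕ → X := ⟨fun x => x.1⟩

/-- The scalar sequence `(f(x_j))_j`, as an element of `ℓ_p`. -/
def WeakSeq.scalar : StrongDual 𝕜 X →ₗ[𝕜] WeakSeq 𝕜 p X →ₗ[𝕜] lp (fun _ : ℕ => 𝕜) p :=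
  LinearMap.mk₂ 𝕜 (fun f x => ⟨fun j => f (x j), x.2 f⟩)
    (fun _ _ _ => rfl) (fun _ _ _ => rfl)
    (fun f x y => by ext j; exact map_add f (x j) (y j))
    (fun c f x => by ext j; exact map_smul f c (x j))

@[simp] theorem WeakSeq.scalar_apply (f : StrongDual 𝕜 X) (x : WeakSeq 𝕜 p X) (j : ℕ) :
    WeakSeq.scalar f x j = f (x j) := rfl

variable [Fact (1 ≤ p)]

/-- `‖(x_j)‖_p^w = sup {‖(f(x_j))_j‖_p : ‖f‖ ≤ 1}`. -/
instance : Norm (WeakSeq 𝕜 p X) :=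
  ⟨fun x => ⨆ f : {f : StrongDual 𝕜 X // ‖f‖ ≤ 1}, ‖WeakSeq.scalar (f : StrongDual 𝕜 X) x‖⟩

theorem WeakSeq.norm_def (x : WeakSeq 𝕜 p X) : ‖x‖ =
    ⨆ f : {f : StrongDual 𝕜 X // ‖f‖ ≤ 1}, ‖WeakSeq.scalar (f : StrongDual 𝕜 X) x‖ := rfl

theorem WeakSeq.core : NormedSpace.Core 𝕜 (WeakSeq 𝕜 p X) ∧
    ∀ (f : StrongDual 𝕜 X) (x : WeakSeq 𝕜 p X), ‖WeakSeq.scalar f x‖ ≤ ‖f‖ * ‖x‖ := by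
  refine sup_norm_core (S := WeakSeq 𝕜 p X) WeakSeq.scalar (fun x => WeakSeq.norm_def x) (fun x => ?_) (fun x hx => ?_)
  · refine lp_bound (WeakSeq.scalar.flip x) fun j => ?_
    exact ContinuousLinearMap.continuous (ContinuousLinearMap.apply 𝕜 𝕜 (x j))
  · refine Subtype.ext (funext fun j => ?_)
    refine SeparatingDual.eq_zero_of_forall_dual_eq_zero (R := 𝕜) fun f => ?_
    have := congrArg (fun a : lp (fun _ : ℕ => 𝕜) p => a j) (hx f)
    simpa using! this

instance : NormedAddCommGroup (WeakSeq 𝕜 p X) := NormedAddCommGroup.ofCore WeakSeq.core.1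

instance : NormedSpace 𝕜 (WeakSeq 𝕜 p X) := NormedSpace.ofCore WeakSeq.core.1

theorem WeakSeq.norm_coord_le (x : WeakSeq 𝕜 p X) (j : ℕ) : ‖x j‖ ≤ ‖x‖ := by
  refine NormedSpace.norm_le_dual_bound 𝕜 (x j) (norm_nonneg _) fun f => ?_
  rw [mul_comm]
  exact (lp_apply_le (WeakSeq.scalar f x) j).trans (WeakSeq.core.2 f x)

theorem WeakSeq.continuous_coord (j : ℕ) : Continuous fun x : WeakSeq 𝕜 p X => x j :=
  AddMonoidHomClass.continuous_of_bound
    ((LinearMap.proj (R := 𝕜) (φ := fun _ : ℕ => X) j).comp (WeakSeq 𝕜 p X).subtype) 1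
    fun x => by rw [one_mul]; exact WeakSeq.norm_coord_le x j

theorem lim_coords [CompleteSpace X] {S : Type*} [NormedAddCommGroup S] (c : S →+ (ℕ → X))
    (hc : ∀ x j, ‖c x j‖ ≤ ‖x‖) (u : ℕ → S) (hu : CauchySeq u) :
    ∃ y : ℕ → X, ∀ j, Filter.Tendsto (fun n => c (u n) j) Filter.atTop (nhds (y j)) := by
  have h : ∀ j, CauchySeq fun n => c (u n) j := by
    intro j
    rw [Metric.cauchySeq_iff] at hu ⊢
    intro ε hε
    obtain ⟨N, hN⟩ := hu ε hε
    refine ⟨N, fun m hm n hn => lt_of_le_of_lt ?_ (hN m hm n hn)⟩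
    rw [dist_eq_norm, dist_eq_norm, ← Pi.sub_apply, ← map_sub]
    exact hc _ j
  choose y hy using fun j => cauchySeq_tendsto_of_complete (h j)
  exact ⟨y, hy⟩

instance [CompleteSpace X] : CompleteSpace (WeakSeq 𝕜 p X) := by
  refine sup_complete WeakSeq.scalar WeakSeq.norm_def WeakSeq.core.2 fun u hu hb => ?_
  obtain ⟨y, hy⟩ := lim_coords
    (S := WeakSeq 𝕜 p X) ((WeakSeq 𝕜 p X).subtype.toAddMonoidHom : _ →+ (ℕ → X))
    WeakSeq.norm_coord_le u hu
  have hy' : ∀ (f : StrongDual 𝕜 X) (j : ℕ),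
      Filter.Tendsto (fun n => WeakSeq.scalar f (u n) j) Filter.atTop (nhds (f (y j))) :=
    fun f j => (f.continuous.tendsto _).comp (hy j)
  exact ⟨⟨y, fun f => lp.memℓp_of_tendsto (hb f) (tendsto_pi_nhds.2 (hy' f))⟩, hy'⟩

/-- The sequence `(x, 0, 0, …)`. -/
def WeakSeq.first (x : X) : WeakSeq 𝕜 p X :=
  ⟨(Pi.single 0 x : ℕ → X), fun f => by
    convert lp.memℓp (lp.single (E := fun _ : ℕ => 𝕜) p 0 (f x)) using 2 with j
    rcases eq_or_ne j 0 with rfl | h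
    · simp
    · simp [h]⟩

theorem WeakSeq.first_zero (x : X) : (WeakSeq.first x : WeakSeq 𝕜 p X) 0 = x :=
  Pi.single_eq_same (M := fun _ : ℕ => X) 0 x

theorem WeakSeq.norm_first_le (x : X) : ‖(WeakSeq.first x : WeakSeq 𝕜 p X)‖ ≤ ‖x‖ := by
  have : Nonempty {f : StrongDual 𝕜 X // ‖f‖ ≤ 1} := ⟨⟨0, by simp⟩⟩
  rw [WeakSeq.norm_def]
  refine ciSup_le fun f => ?_
  have h : WeakSeq.scalar (f : StrongDual 𝕜 X) (WeakSeq.first x : WeakSeq 𝕜 p X) =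
      lp.single (E := fun _ : ℕ => 𝕜) p 0 ((f : StrongDual 𝕜 X) x) := by
    ext j
    change (f : StrongDual 𝕜 X) ((Pi.single 0 x : ℕ → X) j) =
      (Pi.single 0 ((f : StrongDual 𝕜 X) x) : ℕ → 𝕜) j
    rcases eq_or_ne j 0 with rfl | h
    · simp
    · simp [h]
  rw [h, lp.norm_single (zero_lt_one.trans_le Fact.out)]
  calc ‖(f : StrongDual 𝕜 X) x‖ ≤ ‖(f : StrongDual 𝕜 X)‖ * ‖x‖ := ContinuousLinearMap.le_opNorm _ _
    _ ≤ 1 * ‖x‖ := by gcongr; exact f.2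
    _ = ‖x‖ := one_mul _

/-! ### Mid `p`-summable sequences -/

variable (𝕜 p X) in
/-- `ℓ_p^mid(X)`: the sequences `(x_j)` in `X` such that, for every `(f_n) ∈ ℓ_p^w(X*)`, the double
sequence `(f_n(x_j))_{n,j}` is in `ℓ_p(ℕ × ℕ)`; for `p < ∞` this says `∑_n ∑_j |f_n(x_j)|^p < ∞`. -/
def MidSeq : Submodule 𝕜 (PreLp fun _ : ℕ => X) where
  carrier := {x | ∀ f : WeakSeq 𝕜 p (StrongDual 𝕜 X), Memℓp (fun i : ℕ × ℕ => f i.1 (x i.2)) p}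
  zero_mem' f := by simpa using! (zero_memℓp : Memℓp (0 : ℕ × ℕ → 𝕜) p)
  add_mem' {x y} hx hy f := by
    simpa using! (hx f).add (hy f)
  smul_mem' c x hx f := by
    convert (hx f).const_smul c using 2 with i
    exact map_smul (f i.1) c (x i.2)

instance : CoeFun (MidSeq 𝕜 p X) fun _ => ℕ → X := ⟨fun x => x.1⟩

/-- The double sequence `(f_n(x_j))_{n,j}`, as an element of `ℓ_p(ℕ × ℕ)`. -/
def MidSeq.scalar : WeakSeq 𝕜 p (StrongDual 𝕜 X) →ₗ[𝕜] MidSeq 𝕜 p X →ₗ[𝕜]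
    lp (fun _ : ℕ × ℕ => 𝕜) p :=
  LinearMap.mk₂ 𝕜 (fun f x => ⟨fun i => f i.1 (x i.2), x.2 f⟩)
    (fun _ _ _ => rfl) (fun _ _ _ => rfl)
    (fun f x y => by ext i; exact map_add (f i.1) (x i.2) (y i.2))
    (fun c f x => by ext i; exact map_smul (f i.1) c (x i.2))

@[simp] theorem MidSeq.scalar_apply (f : WeakSeq 𝕜 p (StrongDual 𝕜 X)) (x : MidSeq 𝕜 p X)
    (i : ℕ × ℕ) : MidSeq.scalar f x i = f i.1 (x i.2) := rfl

/-- `‖(x_j)‖_p^mid = sup {‖(f_n(x_j))_{n,j}‖_p : ‖(f_n)‖_p^w ≤ 1}`. -/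
instance : Norm (MidSeq 𝕜 p X) :=
  ⟨fun x => ⨆ f : {f : WeakSeq 𝕜 p (StrongDual 𝕜 X) // ‖f‖ ≤ 1},
    ‖MidSeq.scalar (f : WeakSeq 𝕜 p (StrongDual 𝕜 X)) x‖⟩

theorem MidSeq.norm_def (x : MidSeq 𝕜 p X) : ‖x‖ =
    ⨆ f : {f : WeakSeq 𝕜 p (StrongDual 𝕜 X) // ‖f‖ ≤ 1},
      ‖MidSeq.scalar (f : WeakSeq 𝕜 p (StrongDual 𝕜 X)) x‖ := rfl

theorem MidSeq.core : NormedSpace.Core 𝕜 (MidSeq 𝕜 p X) ∧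
    ∀ (f : WeakSeq 𝕜 p (StrongDual 𝕜 X)) (x : MidSeq 𝕜 p X),
      ‖MidSeq.scalar f x‖ ≤ ‖f‖ * ‖x‖ := by
  refine sup_norm_core (S := MidSeq 𝕜 p X) MidSeq.scalar (fun x => MidSeq.norm_def x) (fun x => ?_) (fun x hx => ?_)
  · refine lp_bound (MidSeq.scalar.flip x) fun i => ?_
    exact (ContinuousLinearMap.apply 𝕜 𝕜 (x i.2)).continuous.comp (WeakSeq.continuous_coord i.1)
  · refine Subtype.ext (funext fun j => ?_)
    refine SeparatingDual.eq_zero_of_forall_dual_eq_zero (R := 𝕜) fun f => ?_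
    have := congrArg (fun a : lp (fun _ : ℕ × ℕ => 𝕜) p => a (0, j)) (hx (WeakSeq.first f))
    simpa [WeakSeq.first_zero] using! this

instance : NormedAddCommGroup (MidSeq 𝕜 p X) := NormedAddCommGroup.ofCore MidSeq.core.1

instance : NormedSpace 𝕜 (MidSeq 𝕜 p X) := NormedSpace.ofCore MidSeq.core.1

theorem MidSeq.norm_coord_le (x : MidSeq 𝕜 p X) (j : ℕ) : ‖x j‖ ≤ ‖x‖ := by
  refine NormedSpace.norm_le_dual_bound 𝕜 (x j) (norm_nonneg _) fun f => ?_
  have h1 := lp_apply_le (MidSeq.scalar (WeakSeq.first f) x) (0, j)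
  rw [MidSeq.scalar_apply, WeakSeq.first_zero] at h1
  calc ‖f (x j)‖ ≤ ‖(WeakSeq.first f : WeakSeq 𝕜 p (StrongDual 𝕜 X))‖ * ‖x‖ :=
        h1.trans (MidSeq.core.2 _ x)
    _ ≤ ‖f‖ * ‖x‖ := by gcongr; exact WeakSeq.norm_first_le f
    _ = ‖x‖ * ‖f‖ := mul_comm _ _

theorem MidSeq.continuous_coord (j : ℕ) : Continuous fun x : MidSeq 𝕜 p X => x j :=
  AddMonoidHomClass.continuous_of_bound
    ((LinearMap.proj (R := 𝕜) (φ := fun _ : ℕ => X) j).comp (MidSeq 𝕜 p X).subtype) 1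
    fun x => by rw [one_mul]; exact MidSeq.norm_coord_le x j

instance [CompleteSpace X] : CompleteSpace (MidSeq 𝕜 p X) := by
  refine sup_complete MidSeq.scalar MidSeq.norm_def MidSeq.core.2 fun u hu hb => ?_
  obtain ⟨y, hy⟩ := lim_coords
    (S := MidSeq 𝕜 p X) ((MidSeq 𝕜 p X).subtype.toAddMonoidHom : _ →+ (ℕ → X))
    MidSeq.norm_coord_le u hu
  have hy' : ∀ (f : WeakSeq 𝕜 p (StrongDual 𝕜 X)) (i : ℕ × ℕ),
      Filter.Tendsto (fun n => MidSeq.scalar f (u n) i) Filter.atTop (nhds (f i.1 (y i.2))) :=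
    fun f i => ((f i.1).continuous.tendsto _).comp (hy i.2)
  exact ⟨⟨y, fun f => lp.memℓp_of_tendsto (hb f) (tendsto_pi_nhds.2 (hy' f))⟩, hy'⟩

theorem memlp_column {a : ℕ → 𝕜} (ha : Memℓp a p) (j : ℕ) :
    Memℓp (fun i : ℕ × ℕ => if i.2 = j then a i.1 else 0) p := by
  have h0 : p ≠ 0 := (zero_lt_one.trans_le (Fact.out : 1 ≤ p)).ne'
  rcases p.trichotomy with h | rfl | h
  · exact absurd h h0
  · obtain ⟨C, hC⟩ := memℓp_infty_iff.1 ha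
    refine memℓp_infty_iff.2 ⟨C, ?_⟩
    rintro _ ⟨i, rfl⟩
    have h1 : ‖a i.1‖ ≤ C := hC ⟨i.1, rfl⟩
    by_cases h : i.2 = j
    · simpa [h] using h1
    · simpa [h] using (norm_nonneg _).trans h1
  · refine (memℓp_gen_iff h).2 ?_
    have hinj : Function.Injective fun n : ℕ => (n, j) := fun m n hmn => (Prod.ext_iff.1 hmn).1
    refine (hinj.summable_iff ?_).1 ?_
    · rintro ⟨n, i⟩ hi
      have : i ≠ j := fun h => hi ⟨n, by simp [h]⟩
      simp [this, Real.zero_rpow h.ne']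
    · simpa [Function.comp_def] using (memℓp_gen_iff h).1 ha

theorem MidSeq.exists_coord (j : ℕ) (x : X) : ∃ y : MidSeq 𝕜 p X, y j = x := by
  refine ⟨⟨(Pi.single j x : ℕ → X), fun f => ?_⟩, Pi.single_eq_same (M := fun _ : ℕ => X) j x⟩
  convert memlp_column (f.2 (ContinuousLinearMap.apply 𝕜 𝕜 x)) j using 2 with i
  by_cases h : i.2 = j
  · simp [h]
  · simp [h]

theorem WeakSeq.exists_coord (j : ℕ) (x : X) : ∃ y : WeakSeq 𝕜 p X, y j = x := by
  refine ⟨⟨(Pi.single j x : ℕ → X), fun f => ?_⟩, Pi.single_eq_same (M := fun _ : ℕ => X) j x⟩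
  convert lp.memℓp (lp.single (E := fun _ : ℕ => 𝕜) p j (f x)) using 2 with i
  rcases eq_or_ne i j with rfl | h
  · simp
  · simp [h]

/-! ### Spaces defined by duality -/

theorem pair_core {S : Submodule 𝕜 (PreLp fun _ : ℕ => X)} [Norm S] {B : Type*}
    [NormedAddCommGroup B] [NormedSpace 𝕜 B] [CompleteSpace B]
    (c : ℕ → B →ₗ[𝕜] StrongDual 𝕜 X) (hc : ∀ j, Continuous (c j))
    (hS : ∀ (x : S) (b : B), Summable fun j => ‖c j b (x.1 j)‖)
    (hn : ∀ x : S, ‖x‖ = ⨆ b : {b : B // ‖b‖ ≤ 1}, ∑' j, ‖c j b (x.1 j)‖)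
    (hs : ∀ j f, ∃ b, c j b = f) :
    NormedSpace.Core 𝕜 S ∧ ∀ (b : B) (x : S), ∑' j, ‖c j b (x.1 j)‖ ≤ ‖b‖ * ‖x‖ := by
  let A : B →ₗ[𝕜] S →ₗ[𝕜] lp (fun _ : ℕ => 𝕜) 1 :=
    LinearMap.mk₂ 𝕜 (fun b x => ⟨fun j => c j b (x.1 j), memℓp_gen (by simpa using hS x b)⟩)
      (fun b b' x => by
        ext j
        change c j (b + b') (x.1 j) = c j b (x.1 j) + c j b' (x.1 j)
        rw [map_add]; rfl)
      (fun k b x => by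
        ext j
        change c j (k • b) (x.1 j) = k • c j b (x.1 j)
        rw [map_smul]; rfl)
      (fun b x y => by ext j; exact map_add (c j b) (x.1 j) (y.1 j))
      (fun k b x => by ext j; exact map_smul (c j b) k (x.1 j))
  have hA : ∀ b x, ‖A b x‖ = ∑' j, ‖c j b (x.1 j)‖ := fun b x => by
    rw [lp.norm_eq_tsum_rpow (by simp)]
    simp [A]
  have h := sup_norm_core A (fun x => by simp only [hA]; exact hn x) (fun x => ?_)
    (fun x hx => ?_)
  · exact ⟨h.1, fun b x => by rw [← hA]; exact h.2 b x⟩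
  · refine lp_bound (A.flip x) fun j => ?_
    exact (ContinuousLinearMap.apply 𝕜 𝕜 (x.1 j)).continuous.comp (hc j)
  · refine Subtype.ext (funext fun j => ?_)
    refine SeparatingDual.eq_zero_of_forall_dual_eq_zero (R := 𝕜) fun f => ?_
    obtain ⟨b, hb⟩ := hs j f
    have := congrArg (fun a : lp (fun _ : ℕ => 𝕜) 1 => a j) (hx b)
    rw [← hb]
    exact this

variable (𝕜 p X) in
/-- `(ℓ_p^mid)^dual(X)`: the sequences `(x_j)` in `X` with `∑_j |f_j(x_j)| < ∞` for every
`(f_j) ∈ ℓ_p^mid(X*)`. -/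
def MidDualSeq : Submodule 𝕜 (PreLp fun _ : ℕ => X) where
  carrier := {x | ∀ f : MidSeq 𝕜 p (StrongDual 𝕜 X), Summable fun j => ‖f j (x j)‖}
  zero_mem' f := by
    simp
  add_mem' {x y} hx hy f := by
    refine Summable.of_nonneg_of_le (fun _ => norm_nonneg _) (fun j => ?_) ((hx f).add (hy f))
    simpa using! norm_add_le (f j (x j)) (f j (y j))
  smul_mem' c x hx f := by
    refine ((hx f).mul_left ‖c‖).congr fun j => ?_
    rw [← norm_smul]
    exact congrArg norm (map_smul (f j) c (x j)).symm

instance : CoeFun (MidDualSeq 𝕜 p X) fun _ => ℕ → X := ⟨fun x => x.1⟩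

/-- `‖(x_j)‖_{p,mid}^dual = sup {∑_j |f_j(x_j)| : ‖(f_j)‖_p^mid ≤ 1}`. -/
instance : Norm (MidDualSeq 𝕜 p X) :=
  ⟨fun x => ⨆ f : {f : MidSeq 𝕜 p (StrongDual 𝕜 X) // ‖f‖ ≤ 1},
    ∑' j, ‖(f : MidSeq 𝕜 p (StrongDual 𝕜 X)) j (x j)‖⟩

theorem MidDualSeq.norm_def (x : MidDualSeq 𝕜 p X) : ‖x‖ =
    ⨆ f : {f : MidSeq 𝕜 p (StrongDual 𝕜 X) // ‖f‖ ≤ 1},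
      ∑' j, ‖(f : MidSeq 𝕜 p (StrongDual 𝕜 X)) j (x j)‖ := rfl

theorem MidDualSeq.core : NormedSpace.Core 𝕜 (MidDualSeq 𝕜 p X) ∧
    ∀ (f : MidSeq 𝕜 p (StrongDual 𝕜 X)) (x : MidDualSeq 𝕜 p X),
      ∑' j, ‖f j (x j)‖ ≤ ‖f‖ * ‖x‖ :=
  pair_core (fun j => (LinearMap.proj (R := 𝕜) (φ := fun _ : ℕ => StrongDual 𝕜 X) j).comp
      (MidSeq 𝕜 p (StrongDual 𝕜 X)).subtype) MidSeq.continuous_coord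
    (fun x f => x.2 f) MidDualSeq.norm_def MidSeq.exists_coord

instance : NormedAddCommGroup (MidDualSeq 𝕜 p X) := NormedAddCommGroup.ofCore MidDualSeq.core.1

instance : NormedSpace 𝕜 (MidDualSeq 𝕜 p X) :=
  NormedSpace.ofCore MidDualSeq.core.1

instance one_le_conjExponent (q : ℝ≥0∞) : Fact (1 ≤ q.conjExponent) := ⟨le_self_add⟩

variable (𝕜 X) in
/-- The Cohen space `ℓ_q⟨X⟩`, for `1 ≤ q ≤ ∞`: the sequences `(x_j)` in `X` with
`∑_j |f_j(x_j)| < ∞` for every `(f_j) ∈ ℓ_{q*}^w(X*)`, where `1/q + 1/q* = 1`. -/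
def CohenSeq (q : ℝ≥0∞) : Submodule 𝕜 (PreLp fun _ : ℕ => X) where
  carrier := {x | ∀ f : WeakSeq 𝕜 q.conjExponent (StrongDual 𝕜 X), Summable fun j => ‖f j (x j)‖}
  zero_mem' f := by
    simp
  add_mem' {x y} hx hy f := by
    refine Summable.of_nonneg_of_le (fun _ => norm_nonneg _) (fun j => ?_) ((hx f).add (hy f))
    simpa using! norm_add_le (f j (x j)) (f j (y j))
  smul_mem' c x hx f := by
    refine ((hx f).mul_left ‖c‖).congr fun j => ?_
    rw [← norm_smul]
    exact congrArg norm (map_smul (f j) c (x j)).symm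

variable {q : ℝ≥0∞}

instance : CoeFun (CohenSeq 𝕜 X q) fun _ => ℕ → X := ⟨fun x => x.1⟩

/-- `‖(x_j)‖_{C,q} = sup {∑_j |f_j(x_j)| : ‖(f_j)‖_{q*}^w ≤ 1}`. -/
instance : Norm (CohenSeq 𝕜 X q) :=
  ⟨fun x => ⨆ f : {f : WeakSeq 𝕜 q.conjExponent (StrongDual 𝕜 X) // ‖f‖ ≤ 1},
    ∑' j, ‖(f : WeakSeq 𝕜 q.conjExponent (StrongDual 𝕜 X)) j (x j)‖⟩

theorem CohenSeq.norm_def (x : CohenSeq 𝕜 X q) : ‖x‖ =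
    ⨆ f : {f : WeakSeq 𝕜 q.conjExponent (StrongDual 𝕜 X) // ‖f‖ ≤ 1},
      ∑' j, ‖(f : WeakSeq 𝕜 q.conjExponent (StrongDual 𝕜 X)) j (x j)‖ := rfl

theorem CohenSeq.core : NormedSpace.Core 𝕜 (CohenSeq 𝕜 X q) ∧
    ∀ (f : WeakSeq 𝕜 q.conjExponent (StrongDual 𝕜 X)) (x : CohenSeq 𝕜 X q),
      ∑' j, ‖f j (x j)‖ ≤ ‖f‖ * ‖x‖ :=
  pair_core (fun j => (LinearMap.proj (R := 𝕜) (φ := fun _ : ℕ => StrongDual 𝕜 X) j).comp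
      (WeakSeq 𝕜 q.conjExponent (StrongDual 𝕜 X)).subtype) WeakSeq.continuous_coord
    (fun x f => x.2 f) CohenSeq.norm_def WeakSeq.exists_coord

instance : NormedAddCommGroup (CohenSeq 𝕜 X q) := NormedAddCommGroup.ofCore CohenSeq.core.1

instance : NormedSpace 𝕜 (CohenSeq 𝕜 X q) :=
  NormedSpace.ofCore CohenSeq.core.1

/-! ### Operators acting on sequences -/

variable {Y : Type*} [NormedAddCommGroup Y] [NormedSpace 𝕜 Y]

/-- `R` is the map `T̂ : (x_j)_j ↦ (T x_j)_j` between the sequence spaces `S` and `S'`. -/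
def IsInduced (T : X →L[𝕜] Y) {S : Submodule 𝕜 (PreLp fun _ : ℕ => X)}
    {S' : Submodule 𝕜 (PreLp fun _ : ℕ => Y)} (R : S → S') : Prop :=
  ∀ (x : S) (j : ℕ), (R x).1 j = T (x.1 j)

/-- The adjoint `T* : Y* → X*`, `f ↦ f ∘ T`. -/
def dualOp (T : X →L[𝕜] Y) : StrongDual 𝕜 Y →L[𝕜] StrongDual 𝕜 X := T.precomp 𝕜

theorem dualOp_apply (T : X →L[𝕜] Y) (f : StrongDual 𝕜 Y) (x : X) : dualOp T f x = f (T x) := rfl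

/-- `π_p(T) = ‖T̂ : ℓ_p^w(X) → ℓ_p(Y)‖`, with value `∞` if `T̂` is not a well-defined continuous
map between these spaces. (There is at most one `R` in the infimum.) -/
def summingNorm (p : ℝ≥0∞) [Fact (1 ≤ p)] (T : X →L[𝕜] Y) : ℝ≥0∞ :=
  ⨅ R : {R : WeakSeq 𝕜 p X →L[𝕜] lp (fun _ : ℕ => Y) p //
    ∀ (x : WeakSeq 𝕜 p X) (j : ℕ), R x j = T (x j)}, ‖R.1‖ₑ

/-- `W_p^mid(X, Y)`: the operators `T` for which `T̂ : ℓ_p^w(X) → ℓ_p^mid(Y)` is well defined and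
continuous. -/
def WeaklyMidSumming (𝕜 : Type*) [RCLike 𝕜] (p : ℝ≥0∞) [Fact (1 ≤ p)]
    (X : Type*) [NormedAddCommGroup X] [NormedSpace 𝕜 X]
    (Y : Type*) [NormedAddCommGroup Y] [NormedSpace 𝕜 Y] : Set (X →L[𝕜] Y) :=
  {T | ∃ R : WeakSeq 𝕜 p X →L[𝕜] MidSeq 𝕜 p Y, IsInduced T R}

/-- `w_p^mid(T) = sup {π_p(S ∘ T) : S : Y → ℓ_p, ‖S‖ ≤ 1}`. -/
def wMidNorm (p : ℝ≥0∞) [Fact (1 ≤ p)] (T : X →L[𝕜] Y) : ℝ≥0∞ :=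
  ⨆ S : {S : Y →L[𝕜] lp (fun _ : ℕ => 𝕜) p // ‖S‖ ≤ 1}, summingNorm p (S.1 ∘L T)

/-- `(W_p^mid)^dual(X, Y)`: the operators `T` with `T* ∈ W_p^mid(Y*, X*)`. -/
def WeaklyMidSummingDual (𝕜 : Type*) [RCLike 𝕜] (p : ℝ≥0∞) [Fact (1 ≤ p)]
    (X : Type*) [NormedAddCommGroup X] [NormedSpace 𝕜 X]
    (Y : Type*) [NormedAddCommGroup Y] [NormedSpace 𝕜 Y] : Set (X →L[𝕜] Y) :=
  {T | dualOp T ∈ WeaklyMidSumming 𝕜 p (StrongDual 𝕜 Y) (StrongDual 𝕜 X)}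

/-- `(w_p^mid)^dual(T) = w_p^mid(T*)`. -/
def wMidDualNorm (p : ℝ≥0∞) [Fact (1 ≤ p)] (T : X →L[𝕜] Y) : ℝ≥0∞ := wMidNorm p (dualOp T)

end

/-! Everything is reduced to one inequality on finite matrices, `MidBound p (dualOp T) C`: the `ℓ_p`
norm of every finite section of `(φ_n(T* f_j))` is at most `C ‖f‖ ‖φ‖`, where `f` is a weakly
`p`-summable sequence in `Y*` and `φ` one in `X**`. Some such `C` exists exactly when `T*` is weakly
mid `p`-summing. When it is finite, `w_p^mid(T*)` is itself an admissible `C`, and it is at most any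
other, because operators into `ℓ_p` are the weakly `p`-summable sequences of their coordinate
functionals.

That the inequality gives `‖T̂‖ ≤ C` is direct (`MidBound.exists_induced`): `(T* f_j)` lies in
`ℓ_p^mid(X*)` with norm at most `C ‖f‖`, and it is paired with `(x_j)`.

For the converse (`midBound_dualOp_of_isInduced`), a finite matrix `(φ_n(T* f_j))` is normed by
coefficients `b` of dual norm at most one, so its norm is `|∑_n φ_n(h_n)|` with `h_n = ∑_j b_{nj} T*
f_j`. If `φ_n` were evaluation at `z_n ∈ X`, the sum would equal `∑_j f_j(T x_j)` with `x_j = ∑_n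
b_{nj} z_n`, and `‖(x_j)‖ ≤ ‖(z_n)‖_p^w` (`MidDualSeq.exists_matrix_comb`), so that `‖T̂‖` bounds
it. The passage from `X` to `X**` is `bidual_bound`, which plays the role of local reflexivity: the
weak `ℓ_p` norm on finite families is, up to a factor near one, induced by a map into a finite
`ℓ_∞`-sum of copies of `X`. A Hahn–Banach extension to that sum writes the `h_n` through finitely
many functionals whose norms have controlled sum, and on these the `φ_n` can be estimated directly.
-/

/-! ### Finite sections of the `ℓ_p` norm -/

/-- The `ℓ_p` norm of the finite family `(a_i)_{i ∈ s}`, for `1 ≤ p < ∞`. -/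
noncomputable def finNorm {ι 𝕜 : Type*} [RCLike 𝕜] (p : ℝ≥0∞) (s : Finset ι) (a : ι → 𝕜) : ℝ :=
  (∑ i ∈ s, ‖a i‖ ^ p.toReal) ^ (1 / p.toReal)

section FinNorm

variable {ι 𝕜 : Type*} [RCLike 𝕜] {p : ℝ≥0∞}

theorem finNorm_nonneg (s : Finset ι) (a : ι → 𝕜) : 0 ≤ finNorm p s a := by
  unfold finNorm; positivity

theorem finNorm_congr {s : Finset ι} {a b : ι → 𝕜} (h : ∀ i ∈ s, ‖a i‖ = ‖b i‖) :
    finNorm p s a = finNorm p s b := by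
  unfold finNorm
  rw [Finset.sum_congr rfl fun i hi => by rw [h i hi]]

theorem finNorm_mono {s t : Finset ι} (h : s ⊆ t) (a : ι → 𝕜) :
    finNorm p s a ≤ finNorm p t a := by
  unfold finNorm
  refine Real.rpow_le_rpow (by positivity) ?_ (by positivity)
  exact Finset.sum_le_sum_of_subset_of_nonneg h fun _ _ _ => by positivity

variable [Fact (1 ≤ p)]

theorem toReal_pos_of_ne_top (hp : p ≠ ∞) : 0 < p.toReal :=
  ENNReal.toReal_pos (zero_lt_one.trans_le (Fact.out : 1 ≤ p)).ne' hp

theorem finNorm_le_iff (hp : p ≠ ∞) {s : Finset ι} {a : ι → 𝕜} {C : ℝ} (hC : 0 ≤ C) :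
    finNorm p s a ≤ C ↔ ∑ i ∈ s, ‖a i‖ ^ p.toReal ≤ C ^ p.toReal := by
  unfold finNorm
  rw [one_div, Real.rpow_inv_le_iff_of_pos (by positivity) hC (toReal_pos_of_ne_top hp)]

theorem finNorm_le_norm (hp : p ≠ ∞) (f : lp (fun _ : ι => 𝕜) p) (s : Finset ι) :
    finNorm p s (fun i => f i) ≤ ‖f‖ :=
  (finNorm_le_iff hp (norm_nonneg f)).2
    (lp.sum_rpow_le_norm_rpow (toReal_pos_of_ne_top hp) f s)

theorem memℓp_of_finNorm_le (hp : p ≠ ∞) {a : ι → 𝕜} {C : ℝ} (hC : 0 ≤ C)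
    (h : ∀ s, finNorm p s a ≤ C) : Memℓp a p :=
  memℓp_gen' fun s => (finNorm_le_iff hp hC).1 (h s)

theorem norm_le_of_finNorm_le (hp : p ≠ ∞) (f : lp (fun _ : ι => 𝕜) p) {C : ℝ} (hC : 0 ≤ C)
    (h : ∀ s, finNorm p s (fun i => f i) ≤ C) : ‖f‖ ≤ C :=
  lp.norm_le_of_forall_sum_le (toReal_pos_of_ne_top hp) hC fun s =>
    (finNorm_le_iff hp hC).1 (h s)

/-- Gives finite sections the structure of a finite-dimensional normed space, so that Hahn–Banach
and compactness of the sphere apply. -/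
theorem finNorm_eq_norm_toLp (hp : p ≠ ∞) (s : Finset ι) (a : ι → 𝕜) :
    finNorm p s a = ‖(WithLp.toLp p fun i : s => a i : PiLp p fun _ : s => 𝕜)‖ := by
  rw [PiLp.norm_eq_sum (toReal_pos_of_ne_top hp), finNorm, ← Finset.sum_coe_sort s]

theorem finNorm_smul (hp : p ≠ ∞) (s : Finset ι) (c : 𝕜) (a : ι → 𝕜) :
    finNorm p s (fun i => c * a i) = ‖c‖ * finNorm p s a := by
  rw [finNorm_eq_norm_toLp hp, finNorm_eq_norm_toLp hp, ← norm_smul]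
  rfl

/-- A functional of norm at most one on `ℓ_p^s` is given by a coefficient vector. -/
theorem exists_coeff (hp : p ≠ ∞) (s : Finset ι) (g : StrongDual 𝕜 (PiLp p fun _ : s => 𝕜))
    (hg : ‖g‖ ≤ 1) :
    ∃ b : ι → 𝕜, (∀ a : ι → 𝕜, ∑ i ∈ s, b i * a i = g (WithLp.toLp p fun i : s => a i)) ∧
      ∀ a : ι → 𝕜, ‖∑ i ∈ s, b i * a i‖ ≤ finNorm p s a := by
  classical
  let L : (s → 𝕜) →ₗ[𝕜] 𝕜 :=
    (g : (PiLp p fun _ : s => 𝕜) →ₗ[𝕜] 𝕜) ∘ₗ (WithLp.linearEquiv p 𝕜 (s → 𝕜)).symm.toLinearMap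
  -- The coefficients are the values of `g` on the unit vectors, extended by zero off `s`.
  have key : ∀ a : ι → 𝕜, ∑ i ∈ s, (if h : i ∈ s then L (Pi.single ⟨i, h⟩ 1) else 0) * a i =
      g (WithLp.toLp p fun i : s => a i) := by
    intro a
    rw [← Finset.sum_coe_sort s]
    have h1 : g (WithLp.toLp p fun i : s => a i) = L fun i : s => a i := rfl
    rw [h1, LinearMap.pi_apply_eq_sum_univ L]
    refine Finset.sum_congr rfl fun i _ => ?_
    simp only [i.2, dif_pos, smul_eq_mul]
    rw [mul_comm]
    congr 2
    ext j
    simp [Pi.single_apply, eq_comm]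
  refine ⟨_, key, fun a => ?_⟩
  rw [key, finNorm_eq_norm_toLp hp]
  exact (g.le_opNorm _).trans (mul_le_of_le_one_left (norm_nonneg _) hg)

/-- Hahn–Banach at `a`. The dual norm enters only as an inequality against all `a'`, so no conjugate
exponent appears and `p = 1` needs no separate treatment. -/
theorem exists_norming_coeff (hp : p ≠ ∞) (s : Finset ι) (a : ι → 𝕜) :
    ∃ b : ι → 𝕜, ‖∑ i ∈ s, b i * a i‖ = finNorm p s a ∧
      ∀ a' : ι → 𝕜, ‖∑ i ∈ s, b i * a' i‖ ≤ finNorm p s a' := by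
  obtain ⟨g, hg, hga⟩ := exists_dual_vector'' 𝕜
    (WithLp.toLp p fun i : s => a i : PiLp p fun _ : s => 𝕜)
  obtain ⟨b, hb, hb'⟩ := exists_coeff hp s g hg
  refine ⟨b, ?_, hb'⟩
  rw [hb, hga, finNorm_eq_norm_toLp hp, RCLike.norm_ofReal, abs_of_nonneg (norm_nonneg _)]

end FinNorm

/-! ### Finite-dimensional duality and the passage to the bidual -/

/-- On a finite-dimensional space, finitely many functionals of norm at most one determine the norm
up to a factor arbitrarily close to one. -/
theorem exists_finset_almost_norming (𝕜 : Type*) [RCLike 𝕜] (V : Type*) [NormedAddCommGroup V]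
    [NormedSpace 𝕜 V] [FiniteDimensional 𝕜 V] {θ : ℝ} (hθ : θ < 1) :
    ∃ F : Finset (StrongDual 𝕜 V), (∀ g ∈ F, ‖g‖ ≤ 1) ∧
      ∀ v : V, v ≠ 0 → ∃ g ∈ F, θ * ‖v‖ ≤ ‖g v‖ := by
  have : ProperSpace V := FiniteDimensional.proper 𝕜 V
  choose G hG1 hG2 using fun v : V => exists_dual_vector'' 𝕜 v
  -- A functional norming `v` exceeds `θ` in modulus on a neighbourhood of `v`; compactness of the
  -- unit sphere leaves finitely many.
  obtain ⟨t, ht, hcov⟩ := (isCompact_sphere (0 : V) 1).elim_nhds_subcover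
    (fun v => {w : V | θ < ‖G v w‖}) fun v hv => by
      refine (isOpen_lt continuous_const (G v).continuous.norm).mem_nhds ?_
      have hv1 : ‖v‖ = 1 := by simpa using hv
      simpa [hG2, hv1] using hθ
  classical
  refine ⟨t.image G, ?_, fun v hv => ?_⟩
  · intro g hg
    obtain ⟨v, _, rfl⟩ := Finset.mem_image.1 hg
    exact hG1 v
  · have hv0 : 0 < ‖v‖ := norm_pos_iff.2 hv
    have hmem : ((‖v‖⁻¹ : ℝ) : 𝕜) • v ∈ Metric.sphere (0 : V) 1 := by
      rw [mem_sphere_zero_iff_norm, norm_smul, RCLike.norm_ofReal, abs_of_pos (inv_pos.2 hv0),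
        inv_mul_cancel₀ hv0.ne']
    obtain ⟨w, hw, hvw⟩ := Set.mem_iUnion₂.1 (hcov hmem)
    refine ⟨G w, Finset.mem_image_of_mem G hw, ?_⟩
    have h1 : θ < ‖G w (((‖v‖⁻¹ : ℝ) : 𝕜) • v)‖ := hvw
    rw [map_smul, norm_smul, RCLike.norm_ofReal, abs_of_pos (inv_pos.2 hv0),
      lt_inv_mul_iff₀ hv0, mul_comm] at h1
    exact h1.le

theorem exists_finset_almost_norming_coeff {ι 𝕜 : Type*} [RCLike 𝕜] {p : ℝ≥0∞} [Fact (1 ≤ p)]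
    (hp : p ≠ ∞) (s : Finset ι) {θ : ℝ} (hθ : θ < 1) :
    ∃ F : Finset (ι → 𝕜), (∀ b ∈ F, ∀ a : ι → 𝕜, ‖∑ i ∈ s, b i * a i‖ ≤ finNorm p s a) ∧
      ∀ a : ι → 𝕜, finNorm p s a ≠ 0 → ∃ b ∈ F, θ * finNorm p s a ≤ ‖∑ i ∈ s, b i * a i‖ := by
  classical
  obtain ⟨F, hF1, hF2⟩ := exists_finset_almost_norming 𝕜 (PiLp p fun _ : s => 𝕜) hθ
  choose B hB1 hB2 using fun g : F => exists_coeff hp s g.1 (hF1 g.1 g.2)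
  refine ⟨Finset.univ.image B, ?_, fun a ha => ?_⟩
  · intro b hb
    obtain ⟨g, _, rfl⟩ := Finset.mem_image.1 hb
    exact hB2 g
  · rw [finNorm_eq_norm_toLp hp] at ha ⊢
    obtain ⟨g, hg, hga⟩ := hF2 _ (norm_ne_zero_iff.1 ha)
    refine ⟨B ⟨g, hg⟩, Finset.mem_image_of_mem B (Finset.mem_univ _), ?_⟩
    rw [hB1]
    exact hga

/-- The dual norm of a finite `ℓ_∞`-sum dominates the `ℓ_1`-sum of the norms of the components. -/
theorem sum_norm_single_le {𝕜 X F : Type*} [RCLike 𝕜] [NormedAddCommGroup X] [NormedSpace 𝕜 X]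
    [Fintype F] [DecidableEq F] (k : StrongDual 𝕜 (F → X)) :
    ∑ b, ‖k ∘L ContinuousLinearMap.single 𝕜 (fun _ : F => X) b‖ ≤ ‖k‖ := by
  set κ : F → StrongDual 𝕜 X := fun b => k ∘L ContinuousLinearMap.single 𝕜 (fun _ : F => X) b
  have hx : ∀ (ε : ℝ), 0 < ε → ∀ b, ∃ x : X, ‖x‖ ≤ 1 ∧ ∃ r : ℝ, κ b x = r ∧ ‖κ b‖ - ε ≤ r := by
    intro ε hε b
    obtain ⟨x, hx1, hx2⟩ := (κ b).exists_lt_apply_of_lt_opNorm (sub_lt_self ‖κ b‖ hε)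
    obtain ⟨c, hc1, hc2⟩ := RCLike.exists_norm_eq_mul_self (κ b x)
    refine ⟨c • x, ?_, ‖κ b x‖, ?_, hx2.le⟩
    · rw [norm_smul, hc1, one_mul]; exact hx1.le
    · rw [map_smul, smul_eq_mul, hc2]
  refine le_of_forall_pos_le_add fun ε hε => ?_
  -- The `+ 1` keeps the denominator positive when `F` is empty.
  have hδ : 0 < ε / (Fintype.card F + 1) := by positivity
  choose x hx1 r hr1 hr2 using hx _ hδ
  have hk : k x = ((∑ b, r b : ℝ) : 𝕜) := by
    have h1 : x = ∑ b, ContinuousLinearMap.single 𝕜 (fun _ : F => X) b (x b) := by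
      simpa using! (Finset.univ_sum_single x).symm
    rw [h1, map_sum]
    push_cast
    exact Finset.sum_congr rfl fun b _ => hr1 b
  have h2 : ∑ b, r b ≤ ‖k‖ := by
    have h3 := k.le_opNorm x
    rw [hk, RCLike.norm_ofReal] at h3
    refine (le_abs_self _).trans (h3.trans (mul_le_of_le_one_right (norm_nonneg _) ?_))
    exact (pi_norm_le_iff_of_nonneg zero_le_one).2 hx1
  have h4 : ∑ b, (‖κ b‖ - ε / (Fintype.card F + 1)) ≤ ∑ b, r b :=
    Finset.sum_le_sum fun b _ => hr2 b
  rw [Finset.sum_sub_distrib, Finset.sum_const, Finset.card_univ, nsmul_eq_mul] at h4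
  have h5 : (Fintype.card F : ℝ) * (ε / (Fintype.card F + 1)) ≤ ε := by
    rw [mul_div_assoc', div_le_iff₀ (by positivity)]
    nlinarith
  linarith

/-- A functional on a vector space which is bounded by the seminorm induced from a linear map into a
normed space extends along that map. -/
theorem exists_extend_along {𝕜 Z E : Type*} [RCLike 𝕜] [AddCommGroup Z] [Module 𝕜 Z]
    [NormedAddCommGroup E] [NormedSpace 𝕜 E] (J : Z →ₗ[𝕜] E) (h : Z →ₗ[𝕜] 𝕜) {C : ℝ}
    (hC : 0 ≤ C) (hb : ∀ z, ‖h z‖ ≤ C * ‖J z‖) :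
    ∃ k : StrongDual 𝕜 E, ‖k‖ ≤ C ∧ ∀ z, k (J z) = h z := by
  -- `J` need not be injective, so the functional is defined on its range through a linear section.
  obtain ⟨σ, hσ⟩ := J.rangeRestrict.exists_rightInverse_of_surjective J.range_rangeRestrict
  have hσ' : ∀ y : J.range, J (σ y) = y := fun y =>
    congrArg Subtype.val (LinearMap.congr_fun hσ y)
  let f : StrongDual 𝕜 J.range := (h ∘ₗ σ).mkContinuous C fun y => by
    simpa [hσ'] using hb (σ y)
  obtain ⟨k, hk1, hk2⟩ := exists_extension_norm_eq J.range f
  refine ⟨k, hk2.trans_le (LinearMap.mkContinuous_norm_le _ hC _), fun z => ?_⟩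
  have h1 : k (J z) = h (σ (J.rangeRestrict z)) := hk1 (J.rangeRestrict z)
  rw [h1, ← sub_eq_zero, ← map_sub]
  -- The bound `hb` makes `h` vanish on the kernel of `J`, so the choice of section is immaterial.
  have h2 := hb (σ (J.rangeRestrict z) - z)
  rw [map_sub J, hσ'] at h2
  simpa using h2

/-- If a finite family of functionals, acting on finite families of a normed space, is bounded by
the weak `ℓ_p` norm, then it satisfies the same bound on finite families of the bidual. -/
theorem bidual_bound {ι 𝕜 X : Type*} [RCLike 𝕜] [NormedAddCommGroup X] [NormedSpace 𝕜 X]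
    {p : ℝ≥0∞} [Fact (1 ≤ p)] (hp : p ≠ ∞) (s : Finset ι) (h : ι → StrongDual 𝕜 X) {C : ℝ}
    (hC : 0 ≤ C)
    (hX : ∀ (z : ι → X) (D : ℝ), 0 ≤ D →
      (∀ ξ : StrongDual 𝕜 X, finNorm p s (fun n => ξ (z n)) ≤ D * ‖ξ‖) →
      ‖∑ n ∈ s, h n (z n)‖ ≤ C * D)
    (φ : ι → StrongDual 𝕜 (StrongDual 𝕜 X)) {D : ℝ} (hD : 0 ≤ D)
    (hφ : ∀ ξ : StrongDual 𝕜 X, finNorm p s (fun n => φ n ξ) ≤ D * ‖ξ‖) :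
    ‖∑ n ∈ s, φ n (h n)‖ ≤ C * D := by
  classical
  have main : ∀ θ : ℝ, 0 < θ → θ < 1 → ‖∑ n ∈ s, φ n (h n)‖ ≤ C * θ⁻¹ * D := by
    intro θ h0 h1
    obtain ⟨F, hF1, hF2⟩ := exists_finset_almost_norming_coeff (𝕜 := 𝕜) hp s h1
    let J : (ι → X) →ₗ[𝕜] (F → X) :=
      LinearMap.pi fun b => ∑ n ∈ s, b.1 n • LinearMap.proj n
    have hJ : ∀ z b, J z b = ∑ n ∈ s, b.1 n • z n := fun z b => by simp [J]
    let H : (ι → X) →ₗ[𝕜] 𝕜 := ∑ n ∈ s, (h n : X →ₗ[𝕜] 𝕜) ∘ₗ LinearMap.proj n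
    have hH : ∀ z, H z = ∑ n ∈ s, h n (z n) := fun z => by simp [H]
    -- Since `F` is `θ`-norming, the weak `ℓ_p` norm of `z` is at most `θ⁻¹ ‖J z‖`; this is the `D`
    -- fed to `hX`.
    obtain ⟨k, hk1, hk2⟩ := exists_extend_along J H (C := C * θ⁻¹) (by positivity) fun z => by
      rw [hH, mul_assoc]
      refine hX z _ (by positivity) fun ξ => ?_
      by_cases hz : finNorm p s (fun n => ξ (z n)) = 0
      · rw [hz]; positivity
      obtain ⟨b, hb, hbz⟩ := hF2 _ hz
      rw [mul_assoc, le_inv_mul_iff₀ h0]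
      have h3 : ∑ n ∈ s, b n * ξ (z n) = ξ (J z ⟨b, hb⟩) := by
        rw [hJ, map_sum]
        simp
      rw [h3] at hbz
      calc _ ≤ _ := hbz
        _ ≤ ‖ξ‖ * ‖J z ⟨b, hb⟩‖ := ξ.le_opNorm _
        _ ≤ ‖ξ‖ * ‖J z‖ := by gcongr; exact norm_le_pi_norm _ _
        _ = _ := mul_comm _ _
    let κ : F → StrongDual 𝕜 X := fun b => k ∘L ContinuousLinearMap.single 𝕜 (fun _ : F => X) b
    -- Comparing `H` with `k ∘ J` on families supported at one index expresses each `h n` through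
    -- the components of `k`.
    have hκ : ∀ n ∈ s, h n = ∑ b : F, b.1 n • κ b := by
      intro n hn
      ext x
      have h4 : H (Pi.single n x) = h n x := by
        rw [hH, Finset.sum_eq_single_of_mem n hn fun m _ hm => by simp [hm]]
        simp
      have h5 : J (Pi.single n x) = ∑ b : F, Pi.single b (b.1 n • x) := by
        rw [Finset.univ_sum_single fun b : F => b.1 n • x]
        ext b
        rw [hJ, Finset.sum_eq_single_of_mem n hn fun m _ hm => by simp [hm]]
        simp
      rw [← h4, ← hk2, h5, map_sum, sum_apply]
      refine Finset.sum_congr rfl fun b _ => ?_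
      have h6 : k (Pi.single b (b.1 n • x)) = κ b (b.1 n • x) := rfl
      rw [h6, map_smul]
      rfl
    have h7 : ∑ n ∈ s, φ n (h n) = ∑ b : F, (∑ n ∈ s, b.1 n • φ n) (κ b) := by
      simp only [sum_apply, smul_apply]
      rw [Finset.sum_comm]
      refine Finset.sum_congr rfl fun n hn => ?_
      rw [hκ n hn, map_sum]
      exact Finset.sum_congr rfl fun b _ => map_smul _ _ _
    -- Each `b ∈ F` has dual norm at most one, so the weak bound on `φ` passes to the combination
    -- with coefficients `b`.
    have h8 : ∀ b : F, ‖∑ n ∈ s, b.1 n • φ n‖ ≤ D := fun b =>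
      ContinuousLinearMap.opNorm_le_bound _ hD fun ξ => by
        simp only [sum_apply, smul_apply, smul_eq_mul]
        exact (hF1 b.1 b.2 _).trans (hφ ξ)
    calc _ = ‖∑ b : F, (∑ n ∈ s, b.1 n • φ n) (κ b)‖ := by rw [h7]
      _ ≤ ∑ b : F, D * ‖κ b‖ := norm_sum_le_of_le _ fun b _ =>
          (ContinuousLinearMap.le_opNorm _ _).trans (by gcongr; exact h8 b)
      _ = D * ∑ b : F, ‖κ b‖ := by rw [Finset.mul_sum]
      _ ≤ D * (C * θ⁻¹) := by gcongr; exact (sum_norm_single_le k).trans hk1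
      _ = _ := by ring
  have main' : ∀ θ : ℝ, 0 < θ → θ < 1 → θ * ‖∑ n ∈ s, φ n (h n)‖ ≤ C * D := by
    intro θ h0 h1
    rw [← le_inv_mul_iff₀ h0]
    exact (main θ h0 h1).trans_eq (by ring)
  refine le_of_tendsto (f := fun θ : ℝ => θ * ‖∑ n ∈ s, φ n (h n)‖)
    (x := nhdsWithin 1 (Set.Iio 1)) ?_ ?_
  · have : Filter.Tendsto (fun θ : ℝ => θ * ‖∑ n ∈ s, φ n (h n)‖) (nhds 1)
        (nhds (1 * ‖∑ n ∈ s, φ n (h n)‖)) := (continuous_id.mul continuous_const).tendsto 1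
    rw [one_mul] at this
    exact this.mono_left nhdsWithin_le_nhds
  · filter_upwards [Ioo_mem_nhdsLT (zero_lt_one (α := ℝ))] with θ hθ
    exact main' θ hθ.1 hθ.2

/-! ### Bounds and membership criteria for the sequence spaces -/

section Sequences

variable {𝕜 : Type*} [RCLike 𝕜] {p : ℝ≥0∞} [Fact (1 ≤ p)]
  {E F X Y : Type*} [NormedAddCommGroup E] [NormedSpace 𝕜 E] [NormedAddCommGroup F]
  [NormedSpace 𝕜 F] [NormedAddCommGroup X] [NormedSpace 𝕜 X] [NormedAddCommGroup Y]
  [NormedSpace 𝕜 Y]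

theorem WeakSeq.finNorm_eval_le (hp : p ≠ ∞) (φ : WeakSeq 𝕜 p (StrongDual 𝕜 X)) (x : X)
    (s : Finset ℕ) : finNorm p s (fun n => φ n x) ≤ ‖φ‖ * ‖x‖ := by
  have h := finNorm_le_norm hp (WeakSeq.scalar (NormedSpace.inclusionInDoubleDual 𝕜 X x) φ) s
  refine h.trans ((WeakSeq.core.2 _ φ).trans ?_)
  rw [mul_comm]
  gcongr
  exact NormedSpace.double_dual_bound 𝕜 X x

/-- The weak `ℓ_p` norm of a sequence of functionals can be computed on the predual. -/
theorem WeakSeq.exists_of_eval_bound (hp : p ≠ ∞) (φ : ℕ → StrongDual 𝕜 X) {C : ℝ} (hC : 0 ≤ C)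
    (h : ∀ (x : X) (s : Finset ℕ), finNorm p s (fun n => φ n x) ≤ C * ‖x‖) :
    ∃ ψ : WeakSeq 𝕜 p (StrongDual 𝕜 X), (∀ n, ψ n = φ n) ∧ ‖ψ‖ ≤ C := by
  have key : ∀ (Φ : StrongDual 𝕜 (StrongDual 𝕜 X)) (s : Finset ℕ),
      finNorm p s (fun n => Φ (φ n)) ≤ ‖Φ‖ * C := by
    intro Φ s
    -- Norming coefficients replace the finite `ℓ_p` norm by `Φ` at a single functional on `X`,
    -- whose norm is tested on `X`; thus `Φ` need not come from `X`.
    obtain ⟨b, hb1, hb2⟩ := exists_norming_coeff hp s fun n => Φ (φ n)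
    have h1 : ∑ n ∈ s, b n * Φ (φ n) = Φ (∑ n ∈ s, b n • φ n) := by simp [map_sum]
    rw [← hb1, h1]
    refine (Φ.le_opNorm _).trans ?_
    gcongr
    refine ContinuousLinearMap.opNorm_le_bound _ hC fun x => ?_
    simp only [sum_apply, smul_apply, smul_eq_mul]
    exact (hb2 _).trans (h x s)
  refine ⟨⟨φ, fun Φ => memℓp_of_finNorm_le hp (by positivity) (key Φ)⟩, fun _ => rfl, ?_⟩
  have : Nonempty {Φ : StrongDual 𝕜 (StrongDual 𝕜 X) // ‖Φ‖ ≤ 1} := ⟨⟨0, ContinuousLinearMap.opNorm_zero.trans_le zero_le_one⟩⟩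
  rw [WeakSeq.norm_def]
  refine ciSup_le fun Φ => norm_le_of_finNorm_le hp _ hC fun s => ?_
  exact (key Φ s).trans (mul_le_of_le_one_left hC Φ.2)

theorem MidSeq.finNorm_le (hp : p ≠ ∞) (φ : WeakSeq 𝕜 p (StrongDual 𝕜 X)) (x : MidSeq 𝕜 p X)
    (s : Finset (ℕ × ℕ)) : finNorm p s (fun i => φ i.1 (x i.2)) ≤ ‖φ‖ * ‖x‖ :=
  (finNorm_le_norm hp (MidSeq.scalar φ x) s).trans (MidSeq.core.2 φ x)

theorem MidSeq.exists_of_bound (hp : p ≠ ∞) (x : ℕ → X) {C : ℝ} (hC : 0 ≤ C)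
    (h : ∀ (φ : WeakSeq 𝕜 p (StrongDual 𝕜 X)) (s : Finset (ℕ × ℕ)),
      finNorm p s (fun i => φ i.1 (x i.2)) ≤ C * ‖φ‖) :
    ∃ y : MidSeq 𝕜 p X, (∀ n, y n = x n) ∧ ‖y‖ ≤ C := by
  refine ⟨⟨x, fun φ => memℓp_of_finNorm_le hp (by positivity) (h φ)⟩, fun _ => rfl, ?_⟩
  have : Nonempty {φ : WeakSeq 𝕜 p (StrongDual 𝕜 X) // ‖φ‖ ≤ 1} := ⟨⟨0, by simp⟩⟩
  rw [MidSeq.norm_def]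
  refine ciSup_le fun φ => norm_le_of_finNorm_le hp _ hC fun s => ?_
  exact (h φ s).trans (mul_le_of_le_one_right hC φ.2)

theorem MidDualSeq.exists_of_bound (x : ℕ → X) {C : ℝ} (hC : 0 ≤ C)
    (h : ∀ (g : MidSeq 𝕜 p (StrongDual 𝕜 X)) (s : Finset ℕ), ∑ j ∈ s, ‖g j (x j)‖ ≤ C * ‖g‖) :
    ∃ y : MidDualSeq 𝕜 p X, (∀ n, y n = x n) ∧ ‖y‖ ≤ C := by
  refine ⟨⟨x, fun g => summable_of_sum_le (fun _ => norm_nonneg _) (h g)⟩, fun _ => rfl, ?_⟩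
  have : Nonempty {g : MidSeq 𝕜 p (StrongDual 𝕜 X) // ‖g‖ ≤ 1} := ⟨⟨0, by simp⟩⟩
  rw [MidDualSeq.norm_def]
  refine ciSup_le fun g => Real.tsum_le_of_sum_le (fun _ => norm_nonneg _) fun s => ?_
  exact (h g s).trans (mul_le_of_le_one_right hC g.2)

/-- The exponent equation is a hypothesis so that it can be substituted:
`p.conjExponent.conjExponent` equals `p` only propositionally, and `WeakSeq` depends on it. -/
theorem CohenSeq.sum_le {q : ℝ≥0∞} (hq : q.conjExponent = p) (y : CohenSeq 𝕜 Y q)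
    (f : WeakSeq 𝕜 p (StrongDual 𝕜 Y)) (s : Finset ℕ) :
    ∑ j ∈ s, ‖f j (y j)‖ ≤ ‖f‖ * ‖y‖ := by
  subst hq
  exact ((y.2 f).sum_le_tsum s fun _ _ => norm_nonneg _).trans (CohenSeq.core.2 f y)

theorem CohenSeq.exists_of_bound {q : ℝ≥0∞} (hq : q.conjExponent = p) (x : ℕ → Y) {C : ℝ}
    (hC : 0 ≤ C) (h : ∀ (f : WeakSeq 𝕜 p (StrongDual 𝕜 Y)) (s : Finset ℕ),
      ∑ j ∈ s, ‖f j (x j)‖ ≤ C * ‖f‖) :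
    ∃ y : CohenSeq 𝕜 Y q, (∀ n, y n = x n) ∧ ‖y‖ ≤ C := by
  subst hq
  refine ⟨⟨x, fun g => summable_of_sum_le (fun _ => norm_nonneg _) (h g)⟩, fun _ => rfl, ?_⟩
  have : Nonempty {f : WeakSeq 𝕜 q.conjExponent (StrongDual 𝕜 Y) // ‖f‖ ≤ 1} := ⟨⟨0, by simp⟩⟩
  rw [CohenSeq.norm_def]
  refine ciSup_le fun g => Real.tsum_le_of_sum_le (fun _ => norm_nonneg _) fun s => ?_
  exact (h g s).trans (mul_le_of_le_one_right hC g.2)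

theorem conjExponent_conjExponent (p : ℝ≥0∞) [Fact (1 ≤ p)] :
    p.conjExponent.conjExponent = p := by
  have : ENNReal.HolderConjugate p.conjExponent p := ENNReal.HolderConjugate.symm
  exact ENNReal.HolderConjugate.conjExponent_eq

/-! ### Weakly mid `p`-summing operators -/

/-- The finite inequality `(∑ |φ_n(U x_j)|^p)^{1/p} ≤ C ‖(φ_n)‖_p^w ‖(x_j)‖_p^w`, which describes
the weakly mid `p`-summing operators. -/
def MidBound (p : ℝ≥0∞) [Fact (1 ≤ p)] (U : E →L[𝕜] F) (C : ℝ) : Prop :=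
  ∀ (x : WeakSeq 𝕜 p E) (φ : WeakSeq 𝕜 p (StrongDual 𝕜 F)) (s : Finset (ℕ × ℕ)),
    finNorm p s (fun i => φ i.1 (U (x i.2))) ≤ C * ‖x‖ * ‖φ‖

theorem MidBound.weaklyMidSumming (hp : p ≠ ∞) {U : E →L[𝕜] F} {C : ℝ} (hC : 0 ≤ C)
    (h : MidBound p U C) : U ∈ WeaklyMidSumming 𝕜 p E F := by
  have key : ∀ x : WeakSeq 𝕜 p E, ∃ y : MidSeq 𝕜 p F, (∀ n, y n = U (x n)) ∧ ‖y‖ ≤ C * ‖x‖ :=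
    fun x => MidSeq.exists_of_bound hp (fun n => U (x n)) (by positivity) (h x)
  choose R hR1 hR2 using key
  let L : WeakSeq 𝕜 p E →ₗ[𝕜] MidSeq 𝕜 p F :=
    { toFun := R
      map_add' := fun x y => Subtype.ext <| funext fun j =>
        (hR1 (x + y) j).trans <| (map_add U (x j) (y j)).trans <|
          congrArg₂ _ (hR1 x j).symm (hR1 y j).symm
      map_smul' := fun c x => Subtype.ext <| funext fun j =>
        (hR1 (c • x) j).trans <| (map_smul U c (x j)).trans <| congrArg _ (hR1 x j).symm }
  exact ⟨L.mkContinuous C hR2, hR1⟩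

theorem midBound_of_isInduced (hp : p ≠ ∞) {U : E →L[𝕜] F}
    (Q : WeakSeq 𝕜 p E →L[𝕜] MidSeq 𝕜 p F) (hQ : IsInduced U Q) : MidBound p U ‖Q‖ := by
  intro x φ s
  have h := MidSeq.finNorm_le hp φ (Q x) s
  simp only [hQ x] at h
  rw [mul_comm]
  refine h.trans ?_
  gcongr
  exact Q.le_opNorm x

theorem summingNorm_eq {U : E →L[𝕜] F} (R : WeakSeq 𝕜 p E →L[𝕜] lp (fun _ : ℕ => F) p)
    (hR : ∀ (x : WeakSeq 𝕜 p E) (j : ℕ), R x j = U (x j)) : summingNorm p U = ‖R‖ₑ := by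
  refine le_antisymm (iInf_le_of_le ⟨R, hR⟩ le_rfl) (le_iInf fun R' => ?_)
  have : R'.1 = R := by
    ext x j
    rw [R'.2, hR]
  rw [this]

theorem exists_of_summingNorm_ne_top {U : E →L[𝕜] F} (h : summingNorm p U ≠ ∞) :
    ∃ R : WeakSeq 𝕜 p E →L[𝕜] lp (fun _ : ℕ => F) p,
      ∀ (x : WeakSeq 𝕜 p E) (j : ℕ), R x j = U (x j) := by
  by_contra hn
  have : IsEmpty {R : WeakSeq 𝕜 p E →L[𝕜] lp (fun _ : ℕ => F) p //
    ∀ (x : WeakSeq 𝕜 p E) (j : ℕ), R x j = U (x j)} := ⟨fun R => hn ⟨R.1, R.2⟩⟩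
  exact h (iInf_of_empty _)

/-- The coordinate functionals of `S` form a weakly `p`-summable sequence of norm at most one, and
interchanging the sums over coordinates and over `j` turns `∑_j ‖S(U x_j)‖^p` into the double sum of
`MidBound`. -/
theorem MidBound.summingNorm_comp_le (hp : p ≠ ∞) {U : E →L[𝕜] F} {C : ℝ} (hC : 0 ≤ C)
    (h : MidBound p U C) (S : F →L[𝕜] lp (fun _ : ℕ => 𝕜) p) (hS : ‖S‖ ≤ 1) :
    summingNorm p (S ∘L U) ≤ ENNReal.ofReal C := by
  have hp0 := toReal_pos_of_ne_top hp
  have hcoord : ∀ n y, ‖S y n‖ ≤ ‖S‖ * ‖y‖ := fun n y =>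
    (lp_apply_le (S y) n).trans (S.le_opNorm y)
  let φ₀ : ℕ → StrongDual 𝕜 F := fun n =>
    LinearMap.mkContinuous
      { toFun := fun y => S y n
        map_add' := fun y y' => by simp
        map_smul' := fun c y => by simp } ‖S‖ (hcoord n)
  obtain ⟨φ, hφ1, hφ2⟩ := WeakSeq.exists_of_eval_bound hp φ₀ zero_le_one fun y s =>
    (finNorm_le_norm hp (S y) s).trans ((S.le_opNorm y).trans (by gcongr))
  have hφ : ∀ n y, φ n y = S y n := fun n y => by rw [hφ1]; rfl
  have key : ∀ (x : WeakSeq 𝕜 p E) (J : Finset ℕ),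
      ∑ j ∈ J, ‖S (U (x j))‖ ^ p.toReal ≤ (C * ‖x‖) ^ p.toReal := by
    intro x J
    have hsum : ∀ j, Summable fun n => ‖S (U (x j)) n‖ ^ p.toReal := fun j =>
      (lp.memℓp (S (U (x j)))).summable hp0
    simp only [lp.norm_rpow_eq_tsum hp0]
    rw [← Summable.tsum_finsetSum fun j _ => hsum j]
    refine Real.tsum_le_of_sum_le (fun n => by positivity) fun N => ?_
    have h1 : finNorm p (N ×ˢ J) (fun i => φ i.1 (U (x i.2))) ≤ C * ‖x‖ :=
      (h x φ _).trans (mul_le_of_le_one_right (by positivity) hφ2)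
    rw [finNorm_le_iff hp (by positivity), Finset.sum_product] at h1
    simpa only [hφ] using h1
  let L : WeakSeq 𝕜 p E →ₗ[𝕜] lp (fun _ : ℕ => lp (fun _ : ℕ => 𝕜) p) p :=
    { toFun := fun x => ⟨fun j => S (U (x j)), memℓp_gen' (key x)⟩
      map_add' := fun x y => by
        ext1; funext j
        exact map_add (S ∘L U) (x j) (y j)
      map_smul' := fun c x => by
        ext1; funext j
        exact map_smul (S ∘L U) c (x j) }
  have hL : ∀ x, ‖L x‖ ≤ C * ‖x‖ := fun x =>
    lp.norm_le_of_forall_sum_le hp0 (by positivity) (key x)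
  rw [summingNorm_eq (L.mkContinuous C hL) fun x j => rfl, ← ofReal_norm]
  exact ENNReal.ofReal_le_ofReal (LinearMap.mkContinuous_norm_le _ hC _)

theorem MidBound.wMidNorm_le (hp : p ≠ ∞) {U : E →L[𝕜] F} {C : ℝ} (hC : 0 ≤ C)
    (h : MidBound p U C) : wMidNorm p U ≤ ENNReal.ofReal C :=
  iSup_le fun S => h.summingNorm_comp_le hp hC S.1 S.2

/-- A sequence `φ` of norm at most one defines the contraction `y ↦ (φ_n(y))_n` into `ℓ_p`, which is
a competitor in the supremum; homogeneity covers the other `φ`. -/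
theorem midBound_toReal_wMidNorm (hp : p ≠ ∞) {U : E →L[𝕜] F} (h : wMidNorm p U ≠ ∞) :
    MidBound p U (wMidNorm p U).toReal := by
  have hp0 := toReal_pos_of_ne_top hp
  have key : ∀ (x : WeakSeq 𝕜 p E) (φ : WeakSeq 𝕜 p (StrongDual 𝕜 F)) (s : Finset (ℕ × ℕ)),
      ‖φ‖ ≤ 1 → finNorm p s (fun i => φ i.1 (U (x i.2))) ≤ (wMidNorm p U).toReal * ‖x‖ := by
    intro x φ s hφ
    let S : F →L[𝕜] lp (fun _ : ℕ => 𝕜) p :=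
      LinearMap.mkContinuous
        { toFun := fun y => WeakSeq.scalar (NormedSpace.inclusionInDoubleDual 𝕜 F y) φ
          map_add' := fun y y' => by simp
          map_smul' := fun c y => by simp } 1 fun y => by
        refine norm_le_of_finNorm_le hp _ (by positivity) fun t => ?_
        exact (WeakSeq.finNorm_eval_le hp φ y t).trans (by gcongr)
    have hS : ‖S‖ ≤ 1 := LinearMap.mkContinuous_norm_le _ zero_le_one _
    have hSy : ∀ y n, S y n = φ n y := fun y n => rfl
    have hle : summingNorm p (S ∘L U) ≤ wMidNorm p U :=
      le_iSup (fun S : {S : F →L[𝕜] lp (fun _ : ℕ => 𝕜) p // ‖S‖ ≤ 1} =>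
        summingNorm p (S.1 ∘L U)) ⟨S, hS⟩
    obtain ⟨R, hR⟩ := exists_of_summingNorm_ne_top (ne_top_of_le_ne_top h hle)
    have hRn : ‖R‖ ≤ (wMidNorm p U).toReal := by
      rw [summingNorm_eq R hR] at hle
      rw [← toReal_enorm]
      exact ENNReal.toReal_mono h hle
    -- On a rectangle the sum over `n` for fixed `j` is part of `‖S(U x_j)‖^p`.
    have hs : s ⊆ s.image Prod.fst ×ˢ s.image Prod.snd := Finset.subset_product
    refine (finNorm_mono hs _).trans ?_
    refine le_trans ?_ (R.le_of_opNorm_le hRn x)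
    rw [finNorm_le_iff hp (norm_nonneg _), Finset.sum_product_right]
    refine le_trans (Finset.sum_le_sum fun j _ => ?_)
      (lp.sum_rpow_le_norm_rpow hp0 (R x) (s.image Prod.snd))
    rw [hR]
    exact lp.sum_rpow_le_norm_rpow hp0 (S (U (x j))) _
  intro x φ s
  rcases eq_or_ne φ 0 with rfl | hφ
  · have h1 := finNorm_smul hp s (0 : 𝕜) fun _ => 1
    simp only [zero_mul, norm_zero] at h1
    rw [norm_zero, mul_zero]
    exact h1.le
  · have hφ0 : 0 < ‖φ‖ := norm_pos_iff.2 hφ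
    have h1 := key x (((‖φ‖⁻¹ : ℝ) : 𝕜) • φ) s (by
      rw [norm_smul, RCLike.norm_ofReal, abs_of_pos (inv_pos.2 hφ0), inv_mul_cancel₀ hφ0.ne'])
    have h2 := finNorm_smul hp s ((‖φ‖⁻¹ : ℝ) : 𝕜) fun i => φ i.1 (U (x i.2))
    rw [RCLike.norm_ofReal, abs_of_pos (inv_pos.2 hφ0)] at h2
    have h3 := h2.symm.trans_le h1
    rwa [inv_mul_le_iff₀ hφ0, mul_comm] at h3

/-! ### Duality -/

theorem MidBound.exists_induced (hp : p ≠ ∞) {T : X →L[𝕜] Y} {C : ℝ} (hC : 0 ≤ C)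
    (h : MidBound p (dualOp T) C) :
    ∃ R : MidDualSeq 𝕜 p X →L[𝕜] CohenSeq 𝕜 Y p.conjExponent, IsInduced T R ∧ ‖R‖ ≤ C := by
  have key : ∀ x : MidDualSeq 𝕜 p X, ∃ y : CohenSeq 𝕜 Y p.conjExponent,
      (∀ n, y n = T (x n)) ∧ ‖y‖ ≤ C * ‖x‖ := fun x => by
    refine CohenSeq.exists_of_bound (conjExponent_conjExponent p) _ (by positivity) fun f s => ?_
    -- `MidBound` at `f` says that `(T* f_j)` is mid `p`-summable with norm at most `C ‖f‖`.
    obtain ⟨g, hg1, hg2⟩ := MidSeq.exists_of_bound hp (fun n => dualOp T (f n)) (by positivity)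
      (h f)
    have h1 : ∀ j, f j (T (x j)) = g j (x j) := fun j => by rw [hg1, dualOp_apply]
    simp only [h1]
    calc _ ≤ _ := (x.2 g).sum_le_tsum s fun _ _ => norm_nonneg _
      _ ≤ ‖g‖ * ‖x‖ := MidDualSeq.core.2 g x
      _ ≤ C * ‖f‖ * ‖x‖ := by gcongr
      _ = _ := by ring
  choose R hR1 hR2 using key
  let L : MidDualSeq 𝕜 p X →ₗ[𝕜] CohenSeq 𝕜 Y p.conjExponent :=
    { toFun := R
      map_add' := fun x y => Subtype.ext <| funext fun j =>
        (hR1 (x + y) j).trans <| (map_add T (x j) (y j)).trans <|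
          congrArg₂ _ (hR1 x j).symm (hR1 y j).symm
      map_smul' := fun c x => Subtype.ext <| funext fun j =>
        (hR1 (c • x) j).trans <| (map_smul T c (x j)).trans <| congrArg _ (hR1 x j).symm }
  exact ⟨L.mkContinuous C hR2, hR1, LinearMap.mkContinuous_norm_le _ hC _⟩

/-- Matrix combinations of a finite family `z` lie in `(ℓ_p^mid)^dual`, with norm at most the weak
`ℓ_p` norm of `z` if the matrix has norm at most one as a functional on `ℓ_p(N × J)`. -/
theorem MidDualSeq.exists_matrix_comb (hp : p ≠ ∞) (N J : Finset ℕ) (b : ℕ × ℕ → 𝕜)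
    (hb : ∀ a : ℕ × ℕ → 𝕜, ‖∑ i ∈ N ×ˢ J, b i * a i‖ ≤ finNorm p (N ×ˢ J) a)
    (z : ℕ → X) {D : ℝ} (hD : 0 ≤ D)
    (hz : ∀ ξ : StrongDual 𝕜 X, finNorm p N (fun n => ξ (z n)) ≤ D * ‖ξ‖) :
    ∃ x : MidDualSeq 𝕜 p X, (∀ j ∈ J, x j = ∑ n ∈ N, b (n, j) • z n) ∧ ‖x‖ ≤ D := by
  classical
  -- The family `z`, cut off outside `N` and viewed in `X**`, becomes a test sequence for
  -- `ℓ_p^mid(X*)`.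
  obtain ⟨ζ, hζ1, hζ2⟩ := WeakSeq.exists_of_eval_bound hp
    (fun n => if n ∈ N then NormedSpace.inclusionInDoubleDual 𝕜 X (z n) else 0) hD
    fun ξ s => by
      refine le_trans ?_ (hz ξ)
      rw [finNorm_le_iff hp (finNorm_nonneg _ _)]
      refine le_trans ?_ ((finNorm_le_iff hp (finNorm_nonneg _ _)).1 le_rfl)
      have h1 : ∀ n, ‖(if n ∈ N then NormedSpace.inclusionInDoubleDual 𝕜 X (z n) else 0) ξ‖ ^
          p.toReal = if n ∈ N then ‖ξ (z n)‖ ^ p.toReal else 0 := fun n => by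
        split_ifs
        · simp
        · simp [Real.zero_rpow (toReal_pos_of_ne_top hp).ne']
      simp only [h1]
      rw [Finset.sum_ite_mem]
      exact Finset.sum_le_sum_of_subset_of_nonneg Finset.inter_subset_right
        fun _ _ _ => by positivity
  have hζ : ∀ n ∈ N, ∀ ξ, ζ n ξ = ξ (z n) := fun n hn ξ => by rw [hζ1, if_pos hn]; simp
  obtain ⟨x, hx1, hx2⟩ := MidDualSeq.exists_of_bound (𝕜 := 𝕜) (p := p)
    (fun j => if j ∈ J then ∑ n ∈ N, b (n, j) • z n else 0) hD fun g s => by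
      have h1 : ∑ j ∈ s, ‖g j (if j ∈ J then ∑ n ∈ N, b (n, j) • z n else 0)‖ ≤
          ∑ j ∈ J, ‖g j (∑ n ∈ N, b (n, j) • z n)‖ := by
        have h2 : ∀ j, ‖g j (if j ∈ J then ∑ n ∈ N, b (n, j) • z n else 0)‖ =
            if j ∈ J then ‖g j (∑ n ∈ N, b (n, j) • z n)‖ else 0 := fun j => by
          split_ifs <;> simp
        simp only [h2]
        rw [Finset.sum_ite_mem]
        exact Finset.sum_le_sum_of_subset_of_nonneg Finset.inter_subset_right
          fun _ _ _ => norm_nonneg _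
      refine h1.trans ?_
      -- Unimodular `c_j` remove the absolute values, so that `hb` applies to the matrix `(c_j
      -- g_j(z_n))`; they do not change its `ℓ_p` norm.
      choose c hc1 hc2 using fun j =>
        RCLike.exists_norm_eq_mul_self (g j (∑ n ∈ N, b (n, j) • z n))
      have h3 : ((∑ j ∈ J, ‖g j (∑ n ∈ N, b (n, j) • z n)‖ : ℝ) : 𝕜) =
          ∑ i ∈ N ×ˢ J, b i * (c i.2 * g i.2 (z i.1)) := by
        push_cast
        rw [Finset.sum_product_right]
        refine Finset.sum_congr rfl fun j _ => ?_
        have h5 : ∀ G : StrongDual 𝕜 X, c j * G (∑ n ∈ N, b (n, j) • z n) =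
            ∑ n ∈ N, b (n, j) * (c j * G (z n)) := fun G => by
          rw [map_sum, Finset.mul_sum]
          refine Finset.sum_congr rfl fun n _ => ?_
          rw [map_smul, smul_eq_mul]
          ring
        exact (hc2 j).trans (h5 (g j))
      have h4 : finNorm p (N ×ˢ J) (fun i => c i.2 * g i.2 (z i.1)) =
          finNorm p (N ×ˢ J) (fun i => ζ i.1 (g i.2)) := finNorm_congr fun i hi => by
        rw [norm_mul, hc1, one_mul, hζ _ (Finset.mem_product.1 hi).1]
      calc _ = ‖((∑ j ∈ J, ‖g j (∑ n ∈ N, b (n, j) • z n)‖ : ℝ) : 𝕜)‖ := by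
            rw [RCLike.norm_ofReal, abs_of_nonneg (by positivity)]
        _ ≤ ‖ζ‖ * ‖g‖ := by
            rw [h3]
            exact (hb _).trans (h4.trans_le (MidSeq.finNorm_le hp ζ g _))
        _ ≤ D * ‖g‖ := by gcongr
  exact ⟨x, fun j hj => by rw [hx1, if_pos hj], hx2⟩

theorem midBound_dualOp_of_isInduced (hp : p ≠ ∞) {T : X →L[𝕜] Y}
    (R : MidDualSeq 𝕜 p X →L[𝕜] CohenSeq 𝕜 Y p.conjExponent) (hR : IsInduced T R) :
    MidBound p (dualOp T) ‖R‖ := by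
  intro f φ s
  set N := s.image Prod.fst
  set J := s.image Prod.snd
  have hs : s ⊆ N ×ˢ J := Finset.subset_product
  refine (finNorm_mono hs _).trans ?_
  obtain ⟨b, hb1, hb2⟩ := exists_norming_coeff hp (N ×ˢ J) fun i => φ i.1 (dualOp T (f i.2))
  rw [← hb1]
  have h1 : ∑ i ∈ N ×ˢ J, b i * φ i.1 (dualOp T (f i.2)) =
      ∑ n ∈ N, φ n (∑ j ∈ J, b (n, j) • dualOp T (f j)) := by
    rw [Finset.sum_product]
    simp [map_sum]
  rw [h1]
  -- It now suffices to test the functionals `∑_j b_{nj} T* f_j` on finite families `z` in `X`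
  -- itself.
  refine bidual_bound hp N _ (by positivity) (fun z D hD hz => ?_) (fun n => φ n)
    (norm_nonneg φ) fun ξ => WeakSeq.finNorm_eval_le hp φ ξ N
  obtain ⟨x, hx1, hx2⟩ := MidDualSeq.exists_matrix_comb hp N J b hb2 z hD hz
  have h2 : ∑ n ∈ N, (∑ j ∈ J, b (n, j) • dualOp T (f j)) (z n) = ∑ j ∈ J, f j (R x j) := by
    simp only [sum_apply, smul_apply, dualOp_apply]
    rw [Finset.sum_comm]
    refine Finset.sum_congr rfl fun j hj => ?_
    rw [hR, hx1 j hj]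
    simp [map_sum]
  rw [h2]
  calc _ ≤ ∑ j ∈ J, ‖f j (R x j)‖ := norm_sum_le _ _
    _ ≤ ‖f‖ * ‖R x‖ := CohenSeq.sum_le (conjExponent_conjExponent p) (R x) f J
    _ ≤ ‖f‖ * (‖R‖ * D) := by gcongr; exact R.le_opNorm_of_le hx2
    _ = _ := by ring

theorem IsInduced.unique_dual {T : X →L[𝕜] Y} {q : ℝ≥0∞}
    {R R' : MidDualSeq 𝕜 p X →L[𝕜] CohenSeq 𝕜 Y q} (h : IsInduced T R) (h' : IsInduced T R') :
    R = R' :=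
  ContinuousLinearMap.ext fun x => Subtype.ext <| funext fun j => (h x j).trans (h' x j).symm

theorem exists_isInduced_iff (hp : p ≠ ∞) (T : X →L[𝕜] Y) :
    (∃ R : MidDualSeq 𝕜 p X →L[𝕜] CohenSeq 𝕜 Y p.conjExponent, IsInduced T R) ↔
      dualOp T ∈ WeaklyMidSumming 𝕜 p (StrongDual 𝕜 Y) (StrongDual 𝕜 X) := by
  constructor
  · rintro ⟨R, hR⟩
    exact (midBound_dualOp_of_isInduced hp R hR).weaklyMidSumming hp (norm_nonneg R)
  · rintro ⟨Q, hQ⟩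
    obtain ⟨R, hR, _⟩ := (midBound_of_isInduced hp Q hQ).exists_induced hp (norm_nonneg Q)
    exact ⟨R, hR⟩

theorem wMidNorm_dualOp_eq (hp : p ≠ ∞) {T : X →L[𝕜] Y}
    (R : MidDualSeq 𝕜 p X →L[𝕜] CohenSeq 𝕜 Y p.conjExponent) (hR : IsInduced T R) :
    wMidNorm p (dualOp T) = ‖R‖ₑ := by
  have hle : wMidNorm p (dualOp T) ≤ ‖R‖ₑ := by
    rw [← ofReal_norm]
    exact (midBound_dualOp_of_isInduced hp R hR).wMidNorm_le hp (norm_nonneg R)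
  have hne : wMidNorm p (dualOp T) ≠ ∞ := ne_top_of_le_ne_top enorm_ne_top hle
  obtain ⟨R', hR', hn⟩ :=
    (midBound_toReal_wMidNorm hp hne).exists_induced hp ENNReal.toReal_nonneg
  rw [hR'.unique_dual hR] at hn
  refine le_antisymm hle ?_
  rw [← ofReal_norm]
  exact ENNReal.ofReal_le_of_le_toReal hn

end Sequences

/-! ### The duality theorem -/

theorem mainTheorem6 {𝕜 : Type*} [RCLike 𝕜] (p : ℝ≥0∞) [Fact (1 ≤ p)] (hp : p ≠ ∞)
    (X : Type*) [NormedAddCommGroup X] [NormedSpace 𝕜 X] [CompleteSpace X]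
    (Y : Type*) [NormedAddCommGroup Y] [NormedSpace 𝕜 Y] [CompleteSpace Y] :
    (∀ T : X →L[𝕜] Y,
      ((∃ R : MidDualSeq 𝕜 p X →L[𝕜] CohenSeq 𝕜 Y p.conjExponent, IsInduced T R) ↔
        dualOp T ∈ WeaklyMidSumming 𝕜 p (StrongDual 𝕜 Y) (StrongDual 𝕜 X)) ∧
      ∀ R : MidDualSeq 𝕜 p X →L[𝕜] CohenSeq 𝕜 Y p.conjExponent, IsInduced T R →
        wMidNorm p (dualOp T) = ‖R‖ₑ) ∧
    WeaklyMidSummingDual 𝕜 p X Y =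
      {T | ∃ R : MidDualSeq 𝕜 p X →L[𝕜] CohenSeq 𝕜 Y p.conjExponent, IsInduced T R} ∧
    ∀ T ∈ WeaklyMidSummingDual 𝕜 p X Y,
      ∀ R : MidDualSeq 𝕜 p X →L[𝕜] CohenSeq 𝕜 Y p.conjExponent, IsInduced T R →
        wMidDualNorm p T = ‖R‖ₑ := by
  refine ⟨fun T => ⟨exists_isInduced_iff hp T, fun R hR => wMidNorm_dualOp_eq hp R hR⟩, ?_,
    fun T _ R hR => wMidNorm_dualOp_eq hp R hR⟩
  ext T
  exact (exists_isInduced_iff hp T).symm
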